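/- Let $\alpha>0$ be real, let $\nu>0$ be a real number that is not an integer, and let $0\le a<x$. For a function $f$ on $(a,x)$ write $${}_aI_x^{\alpha}f(x)=\frac1{\Gamma(\alpha)}\int_a^x(x-\tau)^{\alpha-1}f(\tau)\,d\tau$$ for the left-sided Riemann--Liouville fractional integral of order $\alpha$. Let $$I_{\mu}(x)=\Big(\frac x2\Big)^{\mu}\sum_{k=0}^\infty\frac{(x^2/4)^k}{k!\,\Gamma(\mu+k+1)},\qquad K_\nu(x)=\frac{\pi}{2\sin \pi\nu}\,\bigl(I_{-\nu}(x)-I_\nu(x)\bigr)\qquad(x>0)$$ be the modified Bessel functions of the first and second kind, and let $${}_pF_q(a_1,\dots,a_p;b_1,\dots,b_q;z)=\sum_{n=0}^\infty\frac{(a_1)_n\cdots(a_p)_n}{(b_1)_n\cdots(b_q)_n}\,\frac{z^n}{n!}$$ be the hypergeometric series, where $(c)_n=c(c+1)\cdots(c+n-1)$. Then the integral defining ${}_aI_x^{\alpha}\,[x^\nu K_\nu(x)]$ and both infinite series over $k$ below converge absolutely, and $$\begin{aligned} {}_aI_x^{\alpha}\,[x^\nu K_\nu(x)]=\frac{\pi}{2\sin\pi\nu}\Bigg(&\frac{2^\nu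 x^\alpha}{\Gamma(1-\nu)\Gamma(1+\alpha)}\;{}_2F_3\Big(\tfrac12,1;\,1-\nu,\tfrac{\alpha+1}2,\tfrac{\alpha+2}2;\,\tfrac{x^2}4\Big)\\ &-\frac{2^\nu\,\Gamma(\nu+\frac12)}{\sqrt\pi\,\Gamma(\alpha+2\nu+1)}\,x^{\alpha+2\nu}\;{}_1F_2\Big(\nu+\tfrac12;\,\tfrac{\alpha+2\nu+1}2,\tfrac\alpha2+\nu+1;\,\tfrac{x^2}4\Big)\\ &-\frac{a\,2^\nu x^{\alpha-1}}{\Gamma(\alpha)}\sum_{k=0}^\infty\frac{a^{2k}\;{}_2F_1\big(2k+1,1-\alpha;\,2k+2;\,\tfrac ax\big)}{(2k+1)\,\Gamma(-\nu+k+1)\,4^k\,k!}\\ &+\frac{a^{2\nu+1}}{2^\nu\,\Gamma(\alpha)}\,x^{\alpha-1}\sum_{k=0}^\infty\frac{a^{2k}\;{}_2F_1\big(2\nu+2k+1,1-\alpha;\,2\nu+2k+2;\,\tfrac ax\big)}{4^k\,k!\,(2\nu+2k+1)\,\Gamma(\nu+k+1)}\Bigg). \end{aligned}$$ -/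

import Mathlib

/-- The left-sided Riemann–Liouville fractional integral of order `α` of `f`, with lower limit `a`,
evaluated at `x`. -/
noncomputable def rlIntegral (α a : ℝ) (f : ℝ → ℝ) (x : ℝ) : ℝ :=
  1 / Real.Gamma α * ∫ τ in a..x, (x - τ) ^ (α - 1) * f τ

/-- The modified Bessel function of the first kind, of real order `ν`, for a positive argument.
(`Real.Gamma` vanishes at the nonpositive integers and division by zero gives zero, which matches
the usual convention that the reciprocal Gamma function is zero there.) -/
noncomputable def besselI (ν x : ℝ) : ℝ :=
  (x / 2) ^ ν * ∑' k : ℕ, (x ^ 2 / 4) ^ k / ((k.factorial : ℝ) * Real.Gamma (ν + k + 1))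

/-- The modified Bessel function of the second kind, of non-integer real order `ν`, for a positive
argument. -/
noncomputable def besselK (ν x : ℝ) : ℝ :=
  Real.pi / (2 * Real.sin (Real.pi * ν)) * (besselI (-ν) x - besselI ν x)

/-- The generalized hypergeometric series with upper parameters `as` and lower parameters `bs`;
`(ascPochhammer ℝ n).eval c` is the Pochhammer symbol `(c)ₙ = c (c + 1) ⋯ (c + n - 1)`. -/
noncomputable def hypergeometricF (as bs : List ℝ) (x : ℝ) : ℝ :=
  ∑' n : ℕ, (as.map fun c => (ascPochhammer ℝ n).eval c).prod /
    (bs.map fun c => (ascPochhammer ℝ n).eval c).prod * (x ^ n / (n.factorial : ℝ))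

open MeasureTheory

/-!
Write `cₖ(μ) = 1 / (4ᵏ k! Γ(μ + k + 1))`, so that `I_μ(τ) = (τ/2)^μ ∑ cₖ(μ) τ²ᵏ`. For `τ > 0`,
`τ^ν K_ν(τ)` is `π / (2 sin πν)` times
`2^ν ∑ cₖ(-ν) τ²ᵏ - 2^(-ν) τ^(2ν) ∑ cₖ(ν) τ²ᵏ`,
hence a combination of two functions of the form `τ^(p-1) ∑ cₖ(μ) τ²ᵏ`, with `(p, μ) = (1, -ν)` and
`(p, μ) = (2ν + 1, ν)`. Each of them is integrated against `(x - τ)^(α-1)` over `(0, x)` and over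
`(0, a)`, and the results are subtracted. Termwise integration is justified by dominated
convergence (`hasSum_integral_power_series`), the coefficients `cₖ(μ)` decaying fast enough for
`∑ |cₖ(μ)| x²ᵏ` to be finite (`summable_besselCoeff`).

* Over `(0, x)` each term is a Beta integral (`integral_sub_rpow_mul_rpow`). Splitting
  `Γ(z + 2k) = Γ(z) 4ᵏ (z/2)ₖ ((z+1)/2)ₖ` turns the sum into a hypergeometric series
  (`besselCoeff_mul_Gamma_div_Gamma`). For `p = 1` this is the `₂F₃`; for `p = 2ν + 1` the factor
  `(ν + 1)ₖ` cancels, leaving the `₁F₂`, and Legendre's duplication formula gives its constant.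
* Over `(0, a)` with `a < x`, expanding `(1 - τ/x)^(α-1)` in the binomial series evaluates each term
  as a multiple of `₂F₁(p + 2k, 1 - α; p + 2k + 1; a/x)`
  (`integral_sub_rpow_mul_rpow_incomplete`).
-/

/-! ### Complete Beta integrals -/

theorem integral_sub_rpow_mul_rpow {α p x : ℝ} (hα : 0 < α) (hp : 0 < p) (hx : 0 < x) :
    ∫ τ in (0 : ℝ)..x, (x - τ) ^ (α - 1) * τ ^ (p - 1) =
      x ^ (α + p - 1) * (Real.Gamma p * Real.Gamma α / Real.Gamma (α + p)) := by
  have h := Complex.betaIntegral_scaled (p : ℂ) (α : ℂ) hx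
  rw [Complex.betaIntegral_eq_Gamma_mul_div (p : ℂ) (α : ℂ) (by simpa using hp)
    (by simpa using hα)] at h
  have h2 : ∫ τ in (0 : ℝ)..x, (τ : ℂ) ^ ((p : ℂ) - 1) * ((x : ℂ) - τ) ^ ((α : ℂ) - 1) =
      ((∫ τ in (0 : ℝ)..x, (x - τ) ^ (α - 1) * τ ^ (p - 1) : ℝ) : ℂ) := by
    rw [← intervalIntegral.integral_ofReal]
    refine intervalIntegral.integral_congr fun τ hτ => ?_
    rw [Set.uIcc_of_le hx.le] at hτ
    have h1 : 0 ≤ x - τ := by linarith [hτ.2]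
    push_cast [Complex.ofReal_cpow hτ.1, Complex.ofReal_cpow h1]
    ring
  rw [h2] at h
  have h3 : ((x : ℂ) ^ ((p : ℂ) + α - 1)) = ((x ^ (α + p - 1) : ℝ) : ℂ) := by
    rw [Complex.ofReal_cpow hx.le]; push_cast; ring_nf
  rw [h3, ← Complex.ofReal_add, Complex.Gamma_ofReal, Complex.Gamma_ofReal, Complex.Gamma_ofReal] at h
  rw [add_comm p α] at h
  exact_mod_cast h

/-- The integral evaluated in `integral_sub_rpow_mul_rpow` is nonzero, so it is not a junk value and
the integrand is integrable. -/
theorem intervalIntegrable_sub_rpow_mul_rpow {α p x : ℝ} (hα : 0 < α) (hp : 0 < p) (hx : 0 < x) :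
    IntervalIntegrable (fun τ : ℝ => (x - τ) ^ (α - 1) * τ ^ (p - 1)) volume 0 x := by
  refine intervalIntegral.intervalIntegrable_of_integral_ne_zero ?_
  rw [integral_sub_rpow_mul_rpow hα hp hx]
  have := Real.Gamma_pos_of_pos hp
  have := Real.Gamma_pos_of_pos hα
  have := Real.Gamma_pos_of_pos (add_pos hα hp)
  positivity

/-! ### The binomial series and incomplete Beta integrals -/

theorem ringChoose_add_sub_one_eq (b : ℝ) (n : ℕ) :
    Ring.choose (b + n - 1) n = (ascPochhammer ℝ n).eval b / n.factorial := by
  rw [← Ring.multichoose_eq, eq_div_iff (by positivity), mul_comm, ← nsmul_eq_mul,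
    Ring.factorial_nsmul_multichoose_eq_ascPochhammer, Polynomial.ascPochhammer_smeval_eq_eval]

theorem summable_norm_binomial (b : ℝ) {z : ℝ} (hz : |z| < 1) :
    Summable fun n : ℕ => |(ascPochhammer ℝ n).eval b / n.factorial * z ^ n| := by
  have h := Real.one_div_one_sub_rpow_hasFPowerSeriesOnBall_zero b
  have hm : z ∈ Metric.eball (0 : ℝ) 1 := by
    simpa [enorm_eq_nnnorm, ← NNReal.coe_lt_one] using hz
  have := FormalMultilinearSeries.summable_norm_apply _ (Metric.eball_subset_eball h.r_le hm)
  simpa [ringChoose_add_sub_one_eq, abs_mul, abs_div, mul_comm] using this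

theorem hasSum_one_sub_rpow_neg (b : ℝ) {z : ℝ} (hz : |z| < 1) :
    HasSum (fun n : ℕ => (ascPochhammer ℝ n).eval b / n.factorial * z ^ n) ((1 - z) ^ (-b)) := by
  have h := Real.one_div_one_sub_rpow_hasFPowerSeriesOnBall_zero b
  have hm : z ∈ Metric.eball (0 : ℝ) 1 := by
    simpa [enorm_eq_nnnorm, ← NNReal.coe_lt_one] using hz
  have := h.hasSum hm
  have h1 : 0 ≤ 1 - z := by linarith [(abs_lt.1 hz).2]
  simpa [ringChoose_add_sub_one_eq, Real.rpow_neg h1, mul_comm] using this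

theorem ascPochhammer_eval_div_succ {p : ℝ} (hp : 0 < p) (n : ℕ) :
    (ascPochhammer ℝ n).eval p / (ascPochhammer ℝ n).eval (p + 1) = p / (p + n) := by
  have h1 := ascPochhammer_pos n (p + 1) (by linarith)
  rw [div_eq_div_iff h1.ne' (by positivity), ← ascPochhammer_succ_eval]
  simp [ascPochhammer_succ_left, Polynomial.eval_comp]

/-- The incomplete Beta integral as a `₂F₁`, by termwise integration of the binomial series of
`(1 - τ / x) ^ (α - 1)`. No condition on `α` is needed, since the singularity at `τ = x` lies
outside `[0, a]`. -/
theorem integral_sub_rpow_mul_rpow_incomplete {α p a x : ℝ} (hp : 0 < p)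
    (ha : 0 ≤ a) (hx : a < x) :
    ∫ τ in (0 : ℝ)..a, (x - τ) ^ (α - 1) * τ ^ (p - 1) =
      x ^ (α - 1) * (a ^ p / p * ₂F₁ p (1 - α) (p + 1) (a / x)) := by
  have hx0 : 0 < x := ha.trans_lt hx
  have hlt : |a / x| < 1 := by
    rw [abs_of_nonneg (by positivity), div_lt_one hx0]; exact hx
  have hint : IntervalIntegrable (fun τ : ℝ => τ ^ (p - 1)) volume 0 a :=
    intervalIntegral.intervalIntegrable_rpow' (by linarith)
  -- The terms at `τ` are dominated by those at `a`, and the binomial series converges at `a / x < 1`.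
  have key : HasSum (fun n : ℕ => ∫ τ in (0 : ℝ)..a, x ^ (α - 1) *
      ((ascPochhammer ℝ n).eval (1 - α) / n.factorial * (τ / x) ^ n) * τ ^ (p - 1))
      (∫ τ in (0 : ℝ)..a, (x - τ) ^ (α - 1) * τ ^ (p - 1)) := by
    refine intervalIntegral.hasSum_integral_of_dominated_convergence
      (fun n τ => |(ascPochhammer ℝ n).eval (1 - α) / n.factorial * (a / x) ^ n| *
        (x ^ (α - 1) * τ ^ (p - 1))) ?_ ?_ ?_ ?_ ?_
    · intro n
      exact Measurable.aestronglyMeasurable (by fun_prop)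
    · intro n
      refine ae_of_all _ fun τ hτ => ?_
      rw [Set.uIoc_of_le ha] at hτ
      have h0 := hτ.1.le
      rw [Real.norm_eq_abs, abs_mul, abs_mul, abs_mul, abs_mul,
        abs_of_nonneg (Real.rpow_nonneg hx0.le _), abs_of_nonneg (Real.rpow_nonneg h0 _),
        abs_of_nonneg (show 0 ≤ (τ / x) ^ n by positivity),
        abs_of_nonneg (show 0 ≤ (a / x) ^ n by positivity)]
      have : (τ / x) ^ n ≤ (a / x) ^ n := by gcongr; exact hτ.2
      have h2 := Real.rpow_nonneg h0 (p - 1)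
      calc _ = x ^ (α - 1) * (|(ascPochhammer ℝ n).eval (1 - α) / n.factorial| * (τ / x) ^ n) *
            τ ^ (p - 1) := rfl
        _ ≤ x ^ (α - 1) * (|(ascPochhammer ℝ n).eval (1 - α) / n.factorial| * (a / x) ^ n) *
            τ ^ (p - 1) := by gcongr
        _ = _ := by ring
    · exact ae_of_all _ fun τ _ => (summable_norm_binomial (1 - α) hlt).mul_right _
    · simp_rw [tsum_mul_right]
      exact (hint.const_mul _).const_mul _
    · refine ae_of_all _ fun τ hτ => ?_
      rw [Set.uIoc_of_le ha] at hτ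
      have hτx : τ / x ≤ a / x := by gcongr; exact hτ.2
      have hτ0 : 0 ≤ τ / x := div_nonneg hτ.1.le hx0.le
      have h1 : |τ / x| < 1 := by
        rw [abs_of_nonneg hτ0]; exact hτx.trans_lt ((le_abs_self _).trans_lt hlt)
      have := ((hasSum_one_sub_rpow_neg (1 - α) h1).mul_left (x ^ (α - 1))).mul_right (τ ^ (p - 1))
      rwa [neg_sub, ← Real.mul_rpow hx0.le (by linarith [(abs_lt.1 h1).2]),
        mul_sub, mul_one, mul_div_cancel₀ _ hx0.ne'] at this
  rw [← key.tsum_eq, ordinaryHypergeometric_eq_tsum, ← tsum_mul_left, ← tsum_mul_left]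
  refine tsum_congr fun n => ?_
  have hpn : 0 < p + n := by positivity
  have e : ∫ τ in (0 : ℝ)..a, x ^ (α - 1) *
      ((ascPochhammer ℝ n).eval (1 - α) / n.factorial * (τ / x) ^ n) * τ ^ (p - 1) =
      x ^ (α - 1) * ((ascPochhammer ℝ n).eval (1 - α) / n.factorial / x ^ n) *
        ∫ τ in (0 : ℝ)..a, τ ^ (p + n - 1) := by
    rw [← intervalIntegral.integral_const_mul]
    refine intervalIntegral.integral_congr_ae (ae_of_all _ fun τ hτ => ?_)
    rw [Set.uIoc_of_le ha] at hτ
    rw [show p + n - 1 = (p - 1) + n by ring, Real.rpow_add_natCast hτ.1.ne', div_pow]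
    ring
  rw [e, integral_rpow (Or.inl (by linarith)), sub_add_cancel, Real.zero_rpow hpn.ne', sub_zero]
  have hd := ascPochhammer_eval_div_succ hp n
  have ha' : a ^ (p + n) = a ^ p * a ^ n := by
    rw [Real.rpow_add_of_nonneg ha hp.le (by positivity), Real.rpow_natCast]
  rw [ha', smul_eq_mul, div_pow]
  calc _ = x ^ (α - 1) * (a ^ p / p * ((n.factorial : ℝ)⁻¹ * (ascPochhammer ℝ n).eval (1 - α) *
        (p / (p + n)) * (a ^ n / x ^ n))) := by field_simp
    _ = _ := by rw [← hd]; ring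

/-! ### Termwise fractional integration of power series in `τ ^ 2` -/

theorem hasSum_integral_power_series {α p b x : ℝ} {c : ℕ → ℝ} (hα : 0 < α) (hp : 0 < p)
    (hb : 0 ≤ b) (hbx : b ≤ x) (hx : 0 < x) (hc : Summable fun k => |c k| * x ^ (2 * k)) :
    HasSum (fun k => c k * ∫ τ in (0 : ℝ)..b, (x - τ) ^ (α - 1) * τ ^ (p + 2 * k - 1))
      (∫ τ in (0 : ℝ)..b, (x - τ) ^ (α - 1) * (τ ^ (p - 1) * ∑' k, c k * τ ^ (2 * k))) := by
  have hint : IntervalIntegrable (fun τ : ℝ => (x - τ) ^ (α - 1) * τ ^ (p - 1)) volume 0 b :=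
    (intervalIntegrable_sub_rpow_mul_rpow hα hp hx).mono_set
      (by rw [Set.uIcc_of_le hb, Set.uIcc_of_le hx.le]; exact Set.Icc_subset_Icc_right hbx)
  simp_rw [← intervalIntegral.integral_const_mul]
  have hle : ∀ k, ∀ τ ∈ Set.Ioc 0 b, |c k * τ ^ (2 * k)| ≤ |c k| * x ^ (2 * k) := by
    intro k τ hτ
    have h0 := hτ.1.le
    rw [abs_mul, abs_of_nonneg (show 0 ≤ τ ^ (2 * k) by positivity)]
    gcongr
    exact hτ.2.trans hbx
  have he : ∀ k : ℕ, ∀ τ ∈ Set.Ioc 0 b, c k * ((x - τ) ^ (α - 1) * τ ^ (p + 2 * k - 1)) =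
      c k * τ ^ (2 * k) * ((x - τ) ^ (α - 1) * τ ^ (p - 1)) := by
    intro k τ hτ
    rw [show p + 2 * k - 1 = (p - 1) + ((2 * k : ℕ) : ℝ) by push_cast; ring,
      Real.rpow_add_natCast hτ.1.ne']
    ring
  refine intervalIntegral.hasSum_integral_of_dominated_convergence
      (fun k τ => |c k| * x ^ (2 * k) * ((x - τ) ^ (α - 1) * τ ^ (p - 1))) ?_ ?_ ?_ ?_ ?_
  · intro k
    exact Measurable.aestronglyMeasurable (by fun_prop)
  · intro k
    refine ae_of_all _ fun τ hτ => ?_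
    rw [Set.uIoc_of_le hb] at hτ
    have hx1 : 0 ≤ x - τ := by linarith [hτ.2]
    have h1 : 0 ≤ (x - τ) ^ (α - 1) * τ ^ (p - 1) :=
      mul_nonneg (Real.rpow_nonneg hx1 _) (Real.rpow_nonneg hτ.1.le _)
    rw [he k τ hτ, Real.norm_eq_abs, abs_mul, abs_of_nonneg h1]
    exact mul_le_mul_of_nonneg_right (hle k τ hτ) h1
  · exact ae_of_all _ fun τ _ => hc.mul_right _
  · simp_rw [tsum_mul_right]
    exact hint.const_mul _
  · refine ae_of_all _ fun τ hτ => ?_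
    rw [Set.uIoc_of_le hb] at hτ
    have hs : Summable fun k => c k * τ ^ (2 * k) :=
      Summable.of_norm_bounded hc fun k => hle k τ hτ
    refine HasSum.congr_fun ?_ fun k => he k τ hτ
    simpa only [mul_assoc, mul_comm, mul_left_comm] using
      hs.hasSum.mul_right ((x - τ) ^ (α - 1) * τ ^ (p - 1))

theorem intervalIntegrable_power_series {α p x : ℝ} {c : ℕ → ℝ} (hα : 0 < α) (hp : 0 < p)
    (hx : 0 < x) (hc : Summable fun k => |c k| * x ^ (2 * k)) :
    IntervalIntegrable
      (fun τ => (x - τ) ^ (α - 1) * (τ ^ (p - 1) * ∑' k, c k * τ ^ (2 * k))) volume 0 x := by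
  simp_rw [← mul_assoc]
  refine (intervalIntegrable_sub_rpow_mul_rpow hα hp hx).mul_continuousOn ?_
  refine continuousOn_tsum (fun k => by fun_prop) hc fun k τ hτ => ?_
  rw [Set.uIcc_of_le hx.le] at hτ
  have h0 := hτ.1
  rw [Real.norm_eq_abs, abs_mul, abs_of_nonneg (show 0 ≤ τ ^ (2 * k) by positivity)]
  gcongr
  exact hτ.2

/-! ### Coefficients of the modified Bessel functions -/

/-- The coefficient of `τ ^ (2 * k)` in the entire function `(τ / 2) ^ (-μ) * I_μ(τ)`. -/
noncomputable def besselCoeff (μ : ℝ) (k : ℕ) : ℝ :=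
  1 / (4 ^ k * (k.factorial : ℝ) * Real.Gamma (μ + k + 1))

/-- Ratio test; for non-integer `μ` no coefficient vanishes. -/
theorem summable_besselCoeff {μ : ℝ} (hμ : ∀ n : ℤ, μ ≠ n) {x : ℝ} (hx : 0 < x) :
    Summable fun k => |besselCoeff μ k| * x ^ (2 * k) := by
  have hne : ∀ k : ℕ, μ + k + 1 ≠ 0 := fun k h => hμ (-(k + 1)) (by push_cast; linarith)
  have hΓ : ∀ k : ℕ, Real.Gamma (μ + k + 1) ≠ 0 := fun k =>
    Real.Gamma_ne_zero fun m h => hμ (-(m + k + 1)) (by push_cast; linarith)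
  refine summable_of_ratio_test_tendsto_lt_one (l := 0) one_pos ?_ ?_
  · filter_upwards with k
    have := hΓ k
    unfold besselCoeff
    positivity
  · have e : ∀ k : ℕ, ‖|besselCoeff μ (k + 1)| * x ^ (2 * (k + 1))‖ /
        ‖|besselCoeff μ k| * x ^ (2 * k)‖ =
        x ^ 2 / 4 * (1 / ((k : ℝ) + 1)) * |(μ + 1 + k)⁻¹| := by
      intro k
      have h1 := hΓ k
      have h2 := hne k
      have h3 : Real.Gamma (μ + (k + 1 : ℕ) + 1) = (μ + k + 1) * Real.Gamma (μ + k + 1) := by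
        rw [← Real.Gamma_add_one h2]; push_cast; ring_nf
      simp only [besselCoeff, h3, Nat.factorial_succ, norm_mul, norm_div, Real.norm_eq_abs,
        abs_abs, abs_mul, abs_div, abs_inv, abs_pow, abs_of_pos hx, Nat.cast_mul, Nat.abs_cast]
      rw [show μ + 1 + k = μ + k + 1 by ring]
      have h4 := abs_ne_zero.2 h1
      have h5 := abs_ne_zero.2 h2
      have h6 : (k.factorial : ℝ) ≠ 0 := by positivity
      simp only [Nat.abs_ofNat, abs_one]
      push_cast
      have h7 : |(k : ℝ) + 1| = k + 1 := abs_of_pos (by positivity)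
      field_simp
      ring
    simp_rw [e]
    have t1 : Filter.Tendsto (fun k : ℕ => 1 / ((k : ℝ) + 1)) Filter.atTop (nhds 0) :=
      tendsto_one_div_add_atTop_nhds_zero_nat
    have t2 : Filter.Tendsto (fun k : ℕ => |(μ + 1 + k)⁻¹|) Filter.atTop (nhds 0) := by
      have := (Filter.tendsto_atTop_add_const_left Filter.atTop (μ + 1)
        (tendsto_natCast_atTop_atTop (R := ℝ))).inv_tendsto_atTop.abs
      simpa using this
    simpa using (t1.const_mul (x ^ 2 / 4)).mul t2

/-! ### Gamma functions and Pochhammer symbols -/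

theorem Gamma_add_natCast_eq {z : ℝ} (hz : ∀ m : ℕ, z ≠ -m) (k : ℕ) :
    Real.Gamma (z + k) = Real.Gamma z * (ascPochhammer ℝ k).eval z := by
  induction k with
  | zero => simp
  | succ k ih =>
    have : z + k ≠ 0 := fun h => hz k (by linarith)
    rw [Nat.cast_succ, ← add_assoc, Real.Gamma_add_one this, ih, ascPochhammer_succ_eval]
    ring

theorem ascPochhammer_eval_two_mul (z : ℝ) (k : ℕ) :
    (ascPochhammer ℝ (2 * k)).eval z =
      4 ^ k * (ascPochhammer ℝ k).eval (z / 2) * (ascPochhammer ℝ k).eval ((z + 1) / 2) := by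
  induction k with
  | zero => simp
  | succ k ih =>
    rw [show 2 * (k + 1) = 2 * k + 1 + 1 by ring]
    simp only [ascPochhammer_succ_eval, ih]
    push_cast
    ring

/-- The terms obtained by integrating up to `x`, rewritten as hypergeometric terms by splitting
`Γ(p + 2 * k)` and `Γ(q + 2 * k)` into Pochhammer symbols. -/
theorem besselCoeff_mul_Gamma_div_Gamma {μ p q : ℝ} (hμ : ∀ n : ℤ, μ ≠ n) (hp : 0 < p)
    (hq : 0 < q) (x : ℝ) (k : ℕ) :
    besselCoeff μ k * (Real.Gamma (p + 2 * k) / Real.Gamma (q + 2 * k)) * x ^ (2 * k) =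
      Real.Gamma p / (Real.Gamma (μ + 1) * Real.Gamma q) *
        ((ascPochhammer ℝ k).eval (p / 2) * (ascPochhammer ℝ k).eval ((p + 1) / 2) /
          ((ascPochhammer ℝ k).eval (μ + 1) * (ascPochhammer ℝ k).eval (q / 2) *
            (ascPochhammer ℝ k).eval ((q + 1) / 2)) * ((x ^ 2 / 4) ^ k / k.factorial)) := by
  have hpos : ∀ {z : ℝ}, 0 < z → ∀ m : ℕ, z ≠ -m := fun hz m h => by
    have : (0 : ℝ) ≤ m := m.cast_nonneg
    linarith
  have hΓ : ∀ {z : ℝ}, 0 < z → Real.Gamma (z + 2 * k) = Real.Gamma z *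
      (4 ^ k * (ascPochhammer ℝ k).eval (z / 2) * (ascPochhammer ℝ k).eval ((z + 1) / 2)) := by
    intro z hz
    rw [← ascPochhammer_eval_two_mul, ← Gamma_add_natCast_eq (hpos hz)]
    push_cast; rfl
  have hμ' : ∀ m : ℕ, μ + 1 ≠ -m := fun m h => hμ (-(m + 1)) (by push_cast; linarith)
  have hΓμ := Gamma_add_natCast_eq hμ' k
  rw [besselCoeff, show μ + k + 1 = μ + 1 + k by ring, hΓμ, hΓ hp, hΓ hq, div_pow, ← pow_mul]
  have h4 : (4 : ℝ) ^ k ≠ 0 := by positivity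
  field_simp

/-! ### Fractional integrals of the two Bessel series -/

section
variable {α μ p a x : ℝ}

theorem hasSum_integral_zero_right (hα : 0 < α) (hμ : ∀ n : ℤ, μ ≠ n) (hp : 0 < p) (hx : 0 < x) :
    HasSum (fun k : ℕ => x ^ (α + p - 1) * Real.Gamma α * (besselCoeff μ k *
        (Real.Gamma (p + 2 * k) / Real.Gamma (α + p + 2 * k)) * x ^ (2 * k)))
      (∫ τ in (0 : ℝ)..x, (x - τ) ^ (α - 1) *
        (τ ^ (p - 1) * ∑' k, besselCoeff μ k * τ ^ (2 * k))) := by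
  refine HasSum.congr_fun
    (hasSum_integral_power_series hα hp hx.le le_rfl hx (summable_besselCoeff hμ hx)) fun k => ?_
  symm
  rw [integral_sub_rpow_mul_rpow hα (by positivity) hx,
    show α + (p + 2 * k) - 1 = α + p - 1 + ((2 * k : ℕ) : ℝ) by push_cast; ring,
    Real.rpow_add_natCast hx.ne', ← add_assoc]
  ring

theorem hasSum_integral_zero_left (hα : 0 < α) (hμ : ∀ n : ℤ, μ ≠ n) (hp : 0 < p) (ha : 0 ≤ a)
    (hx : a < x) :
    HasSum (fun k : ℕ => a ^ p * x ^ (α - 1) * (besselCoeff μ k * a ^ (2 * k) / (p + 2 * k) *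
        ₂F₁ (p + 2 * k) (1 - α) (p + 2 * k + 1) (a / x)))
      (∫ τ in (0 : ℝ)..a, (x - τ) ^ (α - 1) *
        (τ ^ (p - 1) * ∑' k, besselCoeff μ k * τ ^ (2 * k))) := by
  have hx0 := ha.trans_lt hx
  refine HasSum.congr_fun
    (hasSum_integral_power_series hα hp ha hx.le hx0 (summable_besselCoeff hμ hx0)) fun k => ?_
  symm
  have hpk : 0 < p + 2 * k := by positivity
  rw [integral_sub_rpow_mul_rpow_incomplete hpk ha hx,
    Real.rpow_add_of_nonneg ha hp.le (by positivity),
    show (2 * k : ℝ) = ((2 * k : ℕ) : ℝ) by push_cast; ring, Real.rpow_natCast]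
  ring

/-- The series over `k` converges because its multiple by `a ^ p * x ^ (α - 1)` is the termwise
integrated series over `(0, a)`. -/
theorem summable_besselCoeff_mul_hypergeometric (hα : 0 < α) (hμ : ∀ n : ℤ, μ ≠ n) (hp : 0 < p)
    (ha : 0 ≤ a) (hx : a < x) :
    Summable fun k : ℕ => besselCoeff μ k * a ^ (2 * k) / (p + 2 * k) *
        ₂F₁ (p + 2 * k) (1 - α) (p + 2 * k + 1) (a / x) := by
  rcases ha.eq_or_lt with rfl | ha'
  -- For `a = 0` the factor `a ^ p` vanishes, but only the term `k = 0` of the series survives.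
  · refine summable_of_ne_finset_zero (s := {0}) fun k hk => ?_
    have : k ≠ 0 := by simpa using hk
    simp [this]
  · have hx0 := ha'.trans hx
    exact (summable_mul_left_iff (mul_pos (Real.rpow_pos_of_pos ha' p)
      (Real.rpow_pos_of_pos hx0 (α - 1))).ne').1 (hasSum_integral_zero_left hα hμ hp ha hx).summable

theorem intervalIntegrable_bessel (hα : 0 < α) (hμ : ∀ n : ℤ, μ ≠ n) (hp : 0 < p) (ha : 0 ≤ a)
    (hx : a < x) :
    IntervalIntegrable (fun τ => (x - τ) ^ (α - 1) *
        (τ ^ (p - 1) * ∑' k, besselCoeff μ k * τ ^ (2 * k))) volume a x := by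
  have hx0 := ha.trans_lt hx
  refine (intervalIntegrable_power_series hα hp hx0 (summable_besselCoeff hμ hx0)).mono_set ?_
  rw [Set.uIcc_of_le hx.le, Set.uIcc_of_le hx0.le]
  exact Set.Icc_subset_Icc_left ha

theorem integral_bessel (hα : 0 < α) (hμ : ∀ n : ℤ, μ ≠ n) (hp : 0 < p) (ha : 0 ≤ a)
    (hx : a < x) :
    ∫ τ in a..x, (x - τ) ^ (α - 1) * (τ ^ (p - 1) * ∑' k, besselCoeff μ k * τ ^ (2 * k)) =
      x ^ (α + p - 1) * Real.Gamma α * (Real.Gamma p / (Real.Gamma (μ + 1) * Real.Gamma (α + p)) *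
        ∑' k : ℕ, (ascPochhammer ℝ k).eval (p / 2) * (ascPochhammer ℝ k).eval ((p + 1) / 2) /
          ((ascPochhammer ℝ k).eval (μ + 1) * (ascPochhammer ℝ k).eval ((α + p) / 2) *
            (ascPochhammer ℝ k).eval ((α + p + 1) / 2)) * ((x ^ 2 / 4) ^ k / k.factorial)) -
      a ^ p * x ^ (α - 1) * ∑' k : ℕ, besselCoeff μ k * a ^ (2 * k) / (p + 2 * k) *
        ₂F₁ (p + 2 * k) (1 - α) (p + 2 * k + 1) (a / x) := by
  have hx0 := ha.trans_lt hx
  have hI := intervalIntegrable_power_series hα hp hx0 (summable_besselCoeff hμ hx0)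
  rw [← intervalIntegral.integral_interval_sub_left hI (hI.mono_set ?_),
    ← (hasSum_integral_zero_right hα hμ hp hx0).tsum_eq,
    ← (hasSum_integral_zero_left hα hμ hp ha hx).tsum_eq, tsum_mul_left, tsum_mul_left]
  · simp_rw [besselCoeff_mul_Gamma_div_Gamma hμ hp (add_pos hα hp), tsum_mul_left]
  · rw [Set.uIcc_of_le ha, Set.uIcc_of_le hx0.le]
    exact Set.Icc_subset_Icc_right hx.le

end

/-! ### The Bessel functions as power series -/

theorem besselI_eq (μ : ℝ) (τ : ℝ) :
    besselI μ τ = (τ / 2) ^ μ * ∑' k, besselCoeff μ k * τ ^ (2 * k) := by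
  rw [besselI]
  congr 1
  refine tsum_congr fun k => ?_
  rw [besselCoeff, div_pow, ← pow_mul]
  field_simp

/-- The powers `τ ^ (1 - 1)` and `τ ^ (2 * ν + 1 - 1)` are left in the form `τ ^ (p - 1)` to which
`integral_bessel` applies. -/
theorem rpow_mul_besselK {ν τ : ℝ} (hτ : 0 < τ) :
    τ ^ ν * besselK ν τ = Real.pi / (2 * Real.sin (Real.pi * ν)) *
      (2 ^ ν * (τ ^ ((1 : ℝ) - 1) * ∑' k, besselCoeff (-ν) k * τ ^ (2 * k)) -
        (2 ^ ν)⁻¹ * (τ ^ (2 * ν + 1 - 1) * ∑' k, besselCoeff ν k * τ ^ (2 * k))) := by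
  rw [besselK, besselI_eq, besselI_eq, Real.div_rpow hτ.le two_pos.le,
    Real.div_rpow hτ.le two_pos.le, Real.rpow_neg hτ.le, Real.rpow_neg two_pos.le, sub_self,
    Real.rpow_zero, add_sub_cancel_right, two_mul ν, Real.rpow_add hτ]
  have h1 := (Real.rpow_pos_of_pos hτ ν).ne'
  have h2 := (Real.rpow_pos_of_pos two_pos ν).ne'
  field_simp

/-! ### The fractional integral of `x ^ ν * K_ν(x)` -/

theorem mainTheorem7 (α ν a x : ℝ) (hα : 0 < α) (hν : 0 < ν) (hν_int : ∀ n : ℤ, ν ≠ (n : ℝ))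
    (ha : 0 ≤ a) (hx : a < x) :
    IntervalIntegrable (fun τ : ℝ => (x - τ) ^ (α - 1) * (τ ^ ν * besselK ν τ))
      MeasureTheory.volume a x ∧
    Summable (fun k : ℕ =>
      a ^ (2 * k) * ₂F₁ (2 * (k : ℝ) + 1) (1 - α) (2 * (k : ℝ) + 2) (a / x) /
        ((2 * (k : ℝ) + 1) * Real.Gamma (-ν + k + 1) * 4 ^ k * (k.factorial : ℝ))) ∧
    Summable (fun k : ℕ =>
      a ^ (2 * k) / (4 ^ k * (k.factorial : ℝ) * (2 * ν + 2 * k + 1) * Real.Gamma (ν + k + 1)) *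
        ₂F₁ (2 * ν + 2 * k + 1) (1 - α) (2 * ν + 2 * k + 2) (a / x)) ∧
    rlIntegral α a (fun τ => τ ^ ν * besselK ν τ) x =
      Real.pi / (2 * Real.sin (Real.pi * ν)) *
        (2 ^ ν * x ^ α / (Real.Gamma (1 - ν) * Real.Gamma (1 + α)) *
            hypergeometricF [1 / 2, 1] [1 - ν, (α + 1) / 2, (α + 2) / 2] (x ^ 2 / 4)
          - 2 ^ ν * Real.Gamma (ν + 1 / 2) / (√Real.pi * Real.Gamma (α + 2 * ν + 1)) *
              x ^ (α + 2 * ν) *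
            hypergeometricF [ν + 1 / 2] [(α + 2 * ν + 1) / 2, α / 2 + ν + 1] (x ^ 2 / 4)
          - a * 2 ^ ν * x ^ (α - 1) / Real.Gamma α *
            ∑' k : ℕ,
              a ^ (2 * k) * ₂F₁ (2 * (k : ℝ) + 1) (1 - α) (2 * (k : ℝ) + 2) (a / x) /
                ((2 * (k : ℝ) + 1) * Real.Gamma (-ν + k + 1) * 4 ^ k * (k.factorial : ℝ))
          + a ^ (2 * ν + 1) / (2 ^ ν * Real.Gamma α) * x ^ (α - 1) *
            ∑' k : ℕ,
              a ^ (2 * k) /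
                  (4 ^ k * (k.factorial : ℝ) * (2 * ν + 2 * k + 1) * Real.Gamma (ν + k + 1)) *
                ₂F₁ (2 * ν + 2 * k + 1) (1 - α) (2 * ν + 2 * k + 2) (a / x)) := by
  have hν_int' : ∀ n : ℤ, -ν ≠ n := fun n h => hν_int (-n) (by push_cast; linarith)
  have hp : 0 < 2 * ν + 1 := by positivity
  have e1 : ∀ k : ℕ, a ^ (2 * k) * ₂F₁ (2 * (k : ℝ) + 1) (1 - α) (2 * (k : ℝ) + 2) (a / x) /
        ((2 * (k : ℝ) + 1) * Real.Gamma (-ν + k + 1) * 4 ^ k * (k.factorial : ℝ)) =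
      besselCoeff (-ν) k * a ^ (2 * k) / (1 + 2 * k) *
        ₂F₁ (1 + 2 * (k : ℝ)) (1 - α) (1 + 2 * (k : ℝ) + 1) (a / x) := by
    intro k
    rw [show 1 + 2 * (k : ℝ) + 1 = 2 * k + 2 by ring, add_comm 1 (2 * (k : ℝ)), besselCoeff]
    field_simp
  have e2 : ∀ k : ℕ,
      a ^ (2 * k) / (4 ^ k * (k.factorial : ℝ) * (2 * ν + 2 * k + 1) * Real.Gamma (ν + k + 1)) *
        ₂F₁ (2 * ν + 2 * k + 1) (1 - α) (2 * ν + 2 * k + 2) (a / x) =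
      besselCoeff ν k * a ^ (2 * k) / (2 * ν + 1 + 2 * k) *
        ₂F₁ (2 * ν + 1 + 2 * (k : ℝ)) (1 - α) (2 * ν + 1 + 2 * (k : ℝ) + 1) (a / x) := by
    intro k
    rw [show 2 * ν + 1 + 2 * (k : ℝ) + 1 = 2 * ν + 2 * k + 2 by ring,
      show 2 * ν + 1 + 2 * (k : ℝ) = 2 * ν + 2 * k + 1 by ring, besselCoeff]
    field_simp
  simp_rw [e1, e2]
  have i1 := intervalIntegrable_bessel hα hν_int' one_pos ha hx
  have i2 := intervalIntegrable_bessel hα hν_int hp ha hx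
  have hK : ∀ τ ∈ Set.uIoc a x, Real.pi / (2 * Real.sin (Real.pi * ν)) *
      (2 ^ ν * ((x - τ) ^ (α - 1) *
          (τ ^ ((1 : ℝ) - 1) * ∑' k, besselCoeff (-ν) k * τ ^ (2 * k))) -
        (2 ^ ν)⁻¹ * ((x - τ) ^ (α - 1) *
          (τ ^ (2 * ν + 1 - 1) * ∑' k, besselCoeff ν k * τ ^ (2 * k)))) =
      (x - τ) ^ (α - 1) * (τ ^ ν * besselK ν τ) := by
    intro τ hτ
    rw [Set.uIoc_of_le hx.le] at hτ
    rw [rpow_mul_besselK (ha.trans_lt hτ.1)]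
    ring
  have i3 := ((i1.const_mul (2 ^ ν)).sub (i2.const_mul (2 ^ ν)⁻¹)).const_mul
    (Real.pi / (2 * Real.sin (Real.pi * ν)))
  refine ⟨i3.congr hK, summable_besselCoeff_mul_hypergeometric hα hν_int' one_pos ha hx,
    summable_besselCoeff_mul_hypergeometric hα hν_int hp ha hx, ?_⟩
  rw [rlIntegral, ← intervalIntegral.integral_congr_ae (ae_of_all _ hK),
    intervalIntegral.integral_const_mul,
    intervalIntegral.integral_sub (i1.const_mul _) (i2.const_mul _),
    intervalIntegral.integral_const_mul, intervalIntegral.integral_const_mul,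
    integral_bessel hα hν_int' one_pos ha hx, integral_bessel hα hν_int hp ha hx]
  have hF1 : hypergeometricF [1 / 2, 1] [1 - ν, (α + 1) / 2, (α + 2) / 2] (x ^ 2 / 4) =
      ∑' k : ℕ, (ascPochhammer ℝ k).eval (1 / 2) * (ascPochhammer ℝ k).eval ((1 + 1) / 2) /
          ((ascPochhammer ℝ k).eval (-ν + 1) * (ascPochhammer ℝ k).eval ((α + 1) / 2) *
            (ascPochhammer ℝ k).eval ((α + 1 + 1) / 2)) * ((x ^ 2 / 4) ^ k / k.factorial) := by
    rw [hypergeometricF]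
    refine tsum_congr fun k => ?_
    rw [show (1 + 1 : ℝ) / 2 = 1 by norm_num, show α + 1 + 1 = α + 2 by ring,
      show -ν + 1 = 1 - ν by ring]
    simp [mul_assoc]
  have hF2 : hypergeometricF [ν + 1 / 2] [(α + 2 * ν + 1) / 2, α / 2 + ν + 1] (x ^ 2 / 4) =
      ∑' k : ℕ, (ascPochhammer ℝ k).eval ((2 * ν + 1) / 2) *
          (ascPochhammer ℝ k).eval ((2 * ν + 1 + 1) / 2) /
          ((ascPochhammer ℝ k).eval (ν + 1) * (ascPochhammer ℝ k).eval ((α + (2 * ν + 1)) / 2) *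
            (ascPochhammer ℝ k).eval ((α + (2 * ν + 1) + 1) / 2)) *
          ((x ^ 2 / 4) ^ k / k.factorial) := by
    rw [hypergeometricF]
    refine tsum_congr fun k => ?_
    rw [show (2 * ν + 1) / 2 = ν + 1 / 2 by ring, show (2 * ν + 1 + 1) / 2 = ν + 1 by ring,
      show (α + (2 * ν + 1) + 1) / 2 = α / 2 + ν + 1 by ring,
      show α + (2 * ν + 1) = α + 2 * ν + 1 by ring]
    -- The factor `(ν + 1)ₖ` occurs in both numerator and denominator.
    have := (ascPochhammer_pos k (ν + 1) (by linarith)).ne'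
    simp only [List.map_cons, List.map_nil, List.prod_cons, List.prod_nil, mul_one]
    field_simp
  rw [← hF1, ← hF2]
  -- Legendre's duplication formula at `ν + 1 / 2`.
  have hdup : Real.Gamma (2 * ν + 1) / Real.Gamma (ν + 1) =
      2 ^ ν * 2 ^ ν * Real.Gamma (ν + 1 / 2) / √Real.pi := by
    have h := Real.Gamma_mul_Gamma_add_half (ν + 1 / 2)
    rw [show ν + 1 / 2 + 1 / 2 = ν + 1 by ring, show 2 * (ν + 1 / 2) = 2 * ν + 1 by ring,
      show 1 - (2 * ν + 1) = -(ν + ν) by ring, Real.rpow_neg two_pos.le,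
      Real.rpow_add two_pos] at h
    have h1 : Real.Gamma (ν + 1) ≠ 0 := (Real.Gamma_pos_of_pos (by linarith)).ne'
    have h2 : √Real.pi ≠ 0 := (Real.sqrt_pos.2 Real.pi_pos).ne'
    have h3 := (Real.rpow_pos_of_pos two_pos ν).ne'
    rw [div_eq_div_iff h1 h2, mul_assoc, h]
    field_simp
  have hΓα : Real.Gamma α ≠ 0 := (Real.Gamma_pos_of_pos hα).ne'
  have h2 : (2 : ℝ) ^ ν ≠ 0 := (Real.rpow_pos_of_pos two_pos ν).ne'
  rw [← div_div (Real.Gamma (2 * ν + 1)), hdup, Real.rpow_one, Real.Gamma_one,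
    add_sub_cancel_right, show α + (2 * ν + 1) - 1 = α + 2 * ν by ring,
    show -ν + 1 = 1 - ν by ring, show α + (2 * ν + 1) = α + 2 * ν + 1 by ring, add_comm α 1]
  field_simp
  ring
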